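/- Let $\mu$ be the two-sided product exponential measure on $\mathbb R^n$ (with the Euclidean metric), that is, the probability measure with density $2^{-n}e^{-(|x_1|+\dots+|x_n|)}$. For a measurable set $A\subset\mathbb R^n$ with $\mu(A)>0$ let $\mu_A(B)=\mu(A\cap B)/\mu(A)$ be the normalized restriction of $\mu$ to $A$. For a measurable function $f$ and a probability measure $\nu$ put $$\|f\|_{L^{\psi_1}(\nu)}=\inf\Big\{r>0:\ \int e^{|f|/r}\,d\nu\le 2\Big\},\qquad s^2(\nu)=\sup_{\|g\|_{\mathrm{Lip}}\le 1}\mathrm{Var}_\nu(g),$$ where $\inf\emptyset=\infty$ and the supremum is over all functions $g:\mathbb R^n\to\mathbb R$ with Lipschitz semi-norm at most $1$. There is an absolute constant $c>0$ such that for every $n$, every measurable set $A\subset\mathbb R^n$ with $\mu(A)>0$, and every function $f:A\to\mathbb R$ with $\int f\,d\mu_A=0$ and $\|f\|_{\mathrm{Lip}}\le 1$ on $A$, $$\|f\|_{L^{\psi_1}(\mu_A)}\le c\,\log\Big(\frac{e}{\mu(A)}\Big).$$ In particular, for every $n$ and every such $A$, $$s^2(\mu_A)\le c\,\log^2\Big(\frac{e}{\mu(A)}\Big).$$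 -/

import Mathlib

open MeasureTheory ProbabilityTheory

open scoped ENNReal

noncomputable section

/-- The two-sided product exponential measure on Euclidean space `ℝⁿ`: the measure with density
`2⁻ⁿ exp (-(|x₁| + ⋯ + |xₙ|))` with respect to Lebesgue measure. -/
def twoSidedExp (n : ℕ) : Measure (EuclideanSpace ℝ (Fin n)) :=
  (volume : Measure (EuclideanSpace ℝ (Fin n))).withDensity
    (fun x => ENNReal.ofReal ((2 : ℝ)⁻¹ ^ n * Real.exp (-∑ i, |x i|)))

/-- The Orlicz norm `‖f‖_{L^{ψ_α}(μ)}`: the infimum of all `r > 0` such that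
`∫ exp ((|f| / r) ^ α) dμ ≤ 2`. It is `∞` if there is no such `r`. -/
def psiNorm {M : Type*} [MeasurableSpace M] (α : ℝ) (f : M → ℝ) (μ : Measure M) : ℝ≥0∞ :=
  ⨅ (r : ℝ) (_ : 0 < r)
    (_ : ∫⁻ x, ENNReal.ofReal (Real.exp ((|f x| / r) ^ α)) ∂μ ≤ 2), ENNReal.ofReal r

/-- The spread constant `s²(μ)` of a metric probability space `(M, d, μ)`: the supremum of the
variances (in `[0, ∞]`) of all functions on `M` with Lipschitz semi-norm at most `1`. -/
def spreadConst {M : Type*} [MetricSpace M] [MeasurableSpace M] (μ : Measure M) : ℝ≥0∞ :=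
  ⨆ (f : M → ℝ) (_ : LipschitzWith 1 f), evariance f μ

end

/-! The exponential measure on the line satisfies a Poincaré inequality with constant 4 (a weighted
Hardy inequality on each half-line), and variance tensorizes, so `twoSidedExp n` satisfies one with
the same constant for every `n`. Applied to `exp (s f / 2)` with `f` 1-Lipschitz, it gives `∫ e^{sf}
≤ (1 - s²)⁻¹ (∫ e^{sf/2})²` for `0 < s < 1` (`integral_exp_sub_sq_le`).

Put `Φ(s) = ∫ e^{sf} · ∫ e^{-sf}`, which is unchanged when a constant is added to `f`. Then `Φ(s) ≤
(1 - s²)⁻² Φ(s/2)²`, and iterating down the dyadic scales gives `Φ(1/2) ≤ e²`, whatever the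
dimension and the sup norm of `f`. Truncation removes boundedness, and averaging produces a constant
`m` with `∫ e^{|f-m|/2} ≤ e³`.

Passing to `μ_A` costs a factor `1/μ(A)`, so with `L = log (e/μ(A)) ≥ 1` the moment is at most
`e^{3L}`. By convexity, shrinking the exponent by a factor of order `1/L` brings this down to a
constant, while centring forces `|m| ≤ 6L`; hence the `ψ₁` norm is at most `24L`. A function on `A`
is first extended to a Lipschitz function on the whole space, and the variance bound follows from
`z²/2 ≤ e^z`. -/

noncomputable section

/-! ### Poincaré inequality for the exponential measure on the line -/

/-- The two-sided exponential density on the line. -/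
def laplaceDensity (x : ℝ) : ℝ := 2⁻¹ * Real.exp (-|x|)

/-- The two-sided exponential measure on the line. -/
def laplaceMeasure : Measure ℝ :=
  volume.withDensity fun x => ENNReal.ofReal (laplaceDensity x)

lemma laplaceDensity_nonneg (x : ℝ) : 0 ≤ laplaceDensity x := by
  unfold laplaceDensity; positivity

lemma continuous_laplaceDensity : Continuous laplaceDensity := by
  unfold laplaceDensity; fun_prop

lemma integral_laplaceDensity : ∫ x, laplaceDensity x = 1 := by
  simp only [laplaceDensity]
  rw [integral_const_mul, integral_comp_abs (f := fun x => Real.exp (-x)),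
    integral_exp_neg_Ioi_zero]
  norm_num

lemma integrable_laplaceDensity : Integrable laplaceDensity := by
  refine not_imp_comm.1 integral_undef ?_
  rw [integral_laplaceDensity]; norm_num

instance : IsProbabilityMeasure laplaceMeasure := by
  constructor
  rw [laplaceMeasure, withDensity_apply _ MeasurableSet.univ, Measure.restrict_univ,
    ← ofReal_integral_eq_lintegral_ofReal integrable_laplaceDensity
      (ae_of_all _ laplaceDensity_nonneg), integral_laplaceDensity, ENNReal.ofReal_one]

lemma integrableOn_bounded_mul_exp_neg {h : ℝ → ℝ} (hm : Measurable h) {M : ℝ}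
    (hb : ∀ x, |h x| ≤ M) : IntegrableOn (fun x => h x * Real.exp (-x)) (Set.Ioi 0) := by
  refine Integrable.bdd_mul (c := M) ?_ hm.aestronglyMeasurable (ae_of_all _ hb)
  exact integrableOn_exp_neg_Ioi 0

lemma integral_laplaceMeasure {h : ℝ → ℝ} (hm : Measurable h) {M : ℝ} (hb : ∀ x, |h x| ≤ M) :
    ∫ x, h x ∂laplaceMeasure = 2⁻¹ * ((∫ x in Set.Ioi 0, h x * Real.exp (-x)) +
      ∫ x in Set.Ioi 0, h (-x) * Real.exp (-x)) := by
  have hi : Integrable fun x => h x * laplaceDensity x :=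
    integrable_laplaceDensity.bdd_mul (c := M) hm.aestronglyMeasurable (ae_of_all _ hb)
  rw [laplaceMeasure, integral_withDensity_eq_integral_toReal_smul
    continuous_laplaceDensity.measurable.ennreal_ofReal (by simp)]
  have h1 : ∀ x, (ENNReal.ofReal (laplaceDensity x)).toReal • h x = h x * laplaceDensity x := by
    intro x
    rw [ENNReal.toReal_ofReal (laplaceDensity_nonneg x), smul_eq_mul, mul_comm]
  simp_rw [h1]
  rw [← integral_add_compl (measurableSet_Ioi (a := (0 : ℝ))) hi, Set.compl_Ioi, mul_add,
    show ∫ x in Set.Iic 0, h x * laplaceDensity x =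
      ∫ x in Set.Ioi 0, h (-x) * laplaceDensity (-x) by
        rw [integral_comp_neg_Ioi 0 fun x => h x * laplaceDensity x, neg_zero],
    ← integral_const_mul, ← integral_const_mul]
  congr 1 <;> refine setIntegral_congr_fun measurableSet_Ioi fun x hx => ?_ <;>
    simp only [laplaceDensity, abs_neg, abs_of_pos (Set.mem_Ioi.1 hx)] <;> ring

/-- The weighted Hardy inequality behind the Poincaré inequality of the exponential measure. -/
lemma integral_sq_mul_exp_neg_le {u : ℝ → ℝ} {K : NNReal} (hu : LipschitzWith K u) {M : ℝ}
    (hb : ∀ x, |u x| ≤ M) (h0 : u 0 = 0) :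
    ∫ x in Set.Ioi 0, u x ^ 2 * Real.exp (-x) ≤
      4 * ∫ x in Set.Ioi 0, deriv u x ^ 2 * Real.exp (-x) := by
  have hd : ∀ x, |deriv u x| ≤ K := fun x => norm_deriv_le_of_lipschitz hu
  have hi1 : IntegrableOn (fun x => u x ^ 2 * Real.exp (-x)) (Set.Ioi 0) :=
    integrableOn_bounded_mul_exp_neg (hu.continuous.measurable.pow_const 2) (M := M ^ 2)
      fun x => by rw [abs_pow]; exact pow_le_pow_left₀ (abs_nonneg _) (hb x) 2
  have hi2 : IntegrableOn (fun x => deriv u x ^ 2 * Real.exp (-x)) (Set.Ioi 0) :=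
    integrableOn_bounded_mul_exp_neg ((measurable_deriv u).pow_const 2) (M := K ^ 2)
      fun x => by rw [abs_pow]; exact pow_le_pow_left₀ (abs_nonneg _) (hd x) 2
  have key : ∀ T : ℝ, 0 ≤ T → ∫ x in (0 : ℝ)..T, u x ^ 2 * Real.exp (-x) ≤
      4 * ∫ x in (0 : ℝ)..T, deriv u x ^ 2 * Real.exp (-x) := by
    intro T hT
    have j1 : IntervalIntegrable (fun x => u x ^ 2 * Real.exp (-x)) volume 0 T :=
      (intervalIntegrable_iff_integrableOn_Ioc_of_le hT).2
        (hi1.mono_set Set.Ioc_subset_Ioi_self)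
    have j2 : IntervalIntegrable (fun x => deriv u x ^ 2 * Real.exp (-x)) volume 0 T :=
      (intervalIntegrable_iff_integrableOn_Ioc_of_le hT).2
        (hi2.mono_set Set.Ioc_subset_Ioi_self)
    have a1 : AbsolutelyContinuousOnInterval u 0 T :=
      hu.lipschitzOnWith.absolutelyContinuousOnInterval
    have a2 : AbsolutelyContinuousOnInterval (fun x => Real.exp (-x)) 0 T := 
      ContDiffOn.absolutelyContinuousOnInterval (by fun_prop)
    have a3 := (a1.fun_mul a1).fun_mul a2
    have e := a3.integral_deriv_eq_sub
    simp only [h0, mul_zero, zero_mul, sub_zero] at e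
    -- `(u² e^{-x})' = (2uu' - u²) e^{-x}`, and `2uu' ≤ 2u'² + u²/2` since `(u - 2u')² ≥ 0`. The
    -- boundary term at `0` vanishes and the one at `T` has the favourable sign.
    have e2 : ∫ x in (0 : ℝ)..T, deriv (fun x => u x * u x * Real.exp (-x)) x ≤
        ∫ x in (0 : ℝ)..T, (2 * (deriv u x ^ 2 * Real.exp (-x)) -
          2⁻¹ * (u x ^ 2 * Real.exp (-x))) := by
      refine intervalIntegral.integral_mono_ae hT a3.intervalIntegrable_deriv
        ((j2.const_mul _).sub (j1.const_mul _)) ?_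
      filter_upwards [hu.ae_differentiableAt_real] with x hx
      have := ((hx.hasDerivAt.mul hx.hasDerivAt).mul (hasDerivAt_neg x).exp).deriv
      rw [show (fun x => u x * u x * Real.exp (-x)) = (u * u) * (fun x => Real.exp (-x)) from rfl,
        this]
      simp only [Pi.mul_apply]
      nlinarith [mul_nonneg (sq_nonneg (u x - 2 * deriv u x)) (Real.exp_pos (-x)).le]
    rw [e, intervalIntegral.integral_sub (j2.const_mul _) (j1.const_mul _),
      intervalIntegral.integral_const_mul, intervalIntegral.integral_const_mul] at e2
    have : 0 ≤ u T * u T * Real.exp (-T) := mul_nonneg (mul_self_nonneg _) (Real.exp_pos _).le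
    linarith
  refine le_of_tendsto_of_tendsto
    (intervalIntegral_tendsto_integral_Ioi 0 hi1 Filter.tendsto_id)
    ((intervalIntegral_tendsto_integral_Ioi 0 hi2 Filter.tendsto_id).const_mul 4) ?_
  filter_upwards [Filter.eventually_ge_atTop 0] with T hT using key T hT

/-- The Poincaré inequality of the two-sided exponential measure on the line. -/
lemma laplaceMeasure_poincare {g : ℝ → ℝ} {K : NNReal} (hg : LipschitzWith K g) {M : ℝ}
    (hb : ∀ x, |g x| ≤ M) :
    ∫ x, g x ^ 2 ∂laplaceMeasure - (∫ x, g x ∂laplaceMeasure) ^ 2 ≤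
      4 * ∫ x, deriv g x ^ 2 ∂laplaceMeasure := by
  set u : ℝ → ℝ := fun x => g x - g 0 with hu
  have huL : LipschitzWith K u := by
    refine LipschitzWith.of_dist_le_mul fun x y => ?_
    simpa [hu, Real.dist_eq] using hg.dist_le_mul x y
  have hub : ∀ x, |u x| ≤ M + M := fun x =>
    (abs_sub _ _).trans (add_le_add (hb x) (hb 0))
  have hum := huL.continuous.measurable
  have hud : deriv u = deriv g := by ext x; simp [hu]
  have hd : ∀ x, |deriv u x| ≤ K := fun x => norm_deriv_le_of_lipschitz huL
  have hgi : Integrable g laplaceMeasure :=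
    .of_bound hg.continuous.aestronglyMeasurable M (ae_of_all _ hb)
  have hg2 : Integrable (fun x => g x ^ 2) laplaceMeasure :=
    .of_bound (hg.continuous.pow 2).aestronglyMeasurable (M ^ 2) (ae_of_all _ fun x => by
      rw [Real.norm_eq_abs, abs_pow]; exact pow_le_pow_left₀ (abs_nonneg _) (hb x) 2)
  -- The variance is at most the second moment about any point; the point `g 0` makes `u` vanish at
  -- `0`, as the Hardy inequality on each half-line requires.
  have h1 : ∫ x, g x ^ 2 ∂laplaceMeasure - (∫ x, g x ∂laplaceMeasure) ^ 2 ≤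
      ∫ x, u x ^ 2 ∂laplaceMeasure := by
    have : ∫ x, u x ^ 2 ∂laplaceMeasure = ∫ x, g x ^ 2 ∂laplaceMeasure -
        2 * g 0 * ∫ x, g x ∂laplaceMeasure + g 0 ^ 2 := by
      have : ∀ x, u x ^ 2 = g x ^ 2 - 2 * g 0 * g x + g 0 ^ 2 := fun x => by simp only [hu]; ring
      simp_rw [this]
      rw [integral_add (by exact hg2.sub (hgi.const_mul _)) (integrable_const _),
        integral_sub hg2 (hgi.const_mul _), integral_const_mul]
      simp
    nlinarith [sq_nonneg (∫ x, g x ∂laplaceMeasure - g 0)]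
  refine h1.trans ?_
  rw [← hud, integral_laplaceMeasure (hum.pow_const 2) (M := (M + M) ^ 2) fun x => by
      rw [abs_pow]; exact pow_le_pow_left₀ (abs_nonneg _) (hub x) 2,
    integral_laplaceMeasure ((measurable_deriv u).pow_const 2) (M := K ^ 2) fun x => by
      rw [abs_pow]; exact pow_le_pow_left₀ (abs_nonneg _) (hd x) 2]
  have p := integral_sq_mul_exp_neg_le huL hub (by simp [hu])
  have q := integral_sq_mul_exp_neg_le (u := fun x => u (-x)) (K := K)
    (LipschitzWith.of_dist_le_mul fun x y => by simpa using huL.dist_le_mul (-x) (-y))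
    (fun x => hub (-x)) (by simp [hu])
  simp only [deriv_comp_neg, neg_sq] at q
  linarith

/-! ### Tensorization of the variance -/

lemma integrable_of_abs_le {α : Type*} [MeasurableSpace α] {ν : Measure α} [IsFiniteMeasure ν]
    {φ : α → ℝ} (hφ : Measurable φ) {M : ℝ} (hb : ∀ x, |φ x| ≤ M) : Integrable φ ν :=
  by
  refine .of_bound hφ.aestronglyMeasurable M (ae_of_all _ fun x => ?_)
  rw [Real.norm_eq_abs]
  exact hb x

lemma abs_integral_le_of_abs_le {α : Type*} [MeasurableSpace α] {ν : Measure α}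
    [IsProbabilityMeasure ν] {φ : α → ℝ} {M : ℝ} (hb : ∀ x, |φ x| ≤ M) : |∫ x, φ x ∂ν| ≤ M := by
  simpa using norm_integral_le_of_norm_le_const (μ := ν) (f := φ) (ae_of_all _ hb)

lemma abs_sq_le_of_abs_le {a M : ℝ} (h : |a| ≤ M) : |a ^ 2| ≤ M ^ 2 := by
  rw [abs_pow]; exact pow_le_pow_left₀ (abs_nonneg _) h 2

lemma integral_sub_const_sq {α : Type*} [MeasurableSpace α] {ν : Measure α}
    [IsProbabilityMeasure ν] {φ : α → ℝ} (hφ : Measurable φ) {M : ℝ} (hb : ∀ x, |φ x| ≤ M) :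
    ∫ x, (φ x - ∫ y, φ y ∂ν) ^ 2 ∂ν = ∫ x, φ x ^ 2 ∂ν - (∫ x, φ x ∂ν) ^ 2 := by
  set a := ∫ y, φ y ∂ν with ha
  have h1 := integrable_of_abs_le (ν := ν) hφ hb
  have h2 := integrable_of_abs_le (ν := ν) (hφ.pow_const 2) fun x => abs_sq_le_of_abs_le (hb x)
  have : ∀ x, (φ x - a) ^ 2 = φ x ^ 2 - 2 * a * φ x + a ^ 2 := fun x => by ring
  simp_rw [this]
  rw [integral_add (by exact h2.sub (h1.const_mul _)) (integrable_const _),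
    integral_sub h2 (h1.const_mul _), integral_const_mul, ← ha]
  simp
  ring

lemma sq_integral_le_integral_sq {α : Type*} [MeasurableSpace α] {ν : Measure α}
    [IsProbabilityMeasure ν] {φ : α → ℝ} (hφ : Measurable φ) {M : ℝ} (hb : ∀ x, |φ x| ≤ M) :
    (∫ x, φ x ∂ν) ^ 2 ≤ ∫ x, φ x ^ 2 ∂ν := by
  have := integral_sub_const_sq (ν := ν) hφ hb
  have : 0 ≤ ∫ x, (φ x - ∫ y, φ y ∂ν) ^ 2 ∂ν := integral_nonneg fun x => sq_nonneg _
  linarith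

/-- Tensorization of the variance for a product of two probability measures. -/
lemma prod_variance_le {α β : Type*} [MeasurableSpace α] [MeasurableSpace β] {ν : Measure α}
    {ρ : Measure β} [IsProbabilityMeasure ν] [IsProbabilityMeasure ρ] {g : α × β → ℝ}
    (hg : Measurable g) {M : ℝ} (hb : ∀ p, |g p| ≤ M) {A : α → ℝ} {B : β → ℝ}
    (hAi : Integrable A ν) (hBi : Integrable B ρ)
    (hA : ∀ x, ∫ y, g (x, y) ^ 2 ∂ρ - (∫ y, g (x, y) ∂ρ) ^ 2 ≤ A x)
    (hB : ∀ y, ∫ x, g (x, y) ^ 2 ∂ν - (∫ x, g (x, y) ∂ν) ^ 2 ≤ B y) :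
    ∫ p, g p ^ 2 ∂(ν.prod ρ) - (∫ p, g p ∂(ν.prod ρ)) ^ 2 ≤ ∫ x, A x ∂ν + ∫ y, B y ∂ρ := by
  set h : α → ℝ := fun x => ∫ y, g (x, y) ∂ρ with hh
  set m : β → ℝ := fun y => ∫ x, g (x, y) ∂ν with hm
  have hgb2 : ∀ p, |g p ^ 2| ≤ M ^ 2 := fun p => abs_sq_le_of_abs_le (hb p)
  have hgx : ∀ x, Measurable fun y => g (x, y) := fun x => hg.comp measurable_prodMk_left
  have hgy : ∀ y, Measurable fun x => g (x, y) := fun y => hg.comp measurable_prodMk_right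
  have hhm : Measurable h := (hg.stronglyMeasurable.integral_prod_right' (ν := ρ)).measurable
  have hmm : Measurable m := (hg.stronglyMeasurable.integral_prod_left' (μ := ν)).measurable
  have hhb : ∀ x, |h x| ≤ M := fun x => abs_integral_le_of_abs_le fun y => hb _
  have hmb : ∀ y, |m y| ≤ M := fun y => abs_integral_le_of_abs_le fun x => hb _
  have gi := integrable_of_abs_le (ν := ν.prod ρ) hg hb
  have g2i := integrable_of_abs_le (ν := ν.prod ρ) (hg.pow_const 2) hgb2
  have h2i := integrable_of_abs_le (ν := ν) (hhm.pow_const 2) fun x => abs_sq_le_of_abs_le (hhb x)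
  have m2i := integrable_of_abs_le (ν := ρ) (hmm.pow_const 2) fun x => abs_sq_le_of_abs_le (hmb x)
  have G1 : ∫ p, g p ^ 2 ∂(ν.prod ρ) - ∫ x, h x ^ 2 ∂ν ≤ ∫ x, A x ∂ν := by
    rw [integral_prod _ g2i, ← integral_sub g2i.integral_prod_left h2i]
    exact integral_mono (g2i.integral_prod_left.sub h2i) hAi hA
  have G2 : ∫ p, g p ^ 2 ∂(ν.prod ρ) - ∫ y, m y ^ 2 ∂ρ ≤ ∫ y, B y ∂ρ := by
    rw [integral_prod_symm _ g2i, ← integral_sub g2i.integral_prod_right m2i]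
    exact integral_mono (g2i.integral_prod_right.sub m2i) hBi hB
  have e1 : ∫ p, g p ∂(ν.prod ρ) = ∫ x, h x ∂ν := integral_prod _ gi
  have e2 : ∫ p, g p ∂(ν.prod ρ) = ∫ y, m y ∂ρ := integral_prod_symm _ gi
  have dm : Measurable fun p : α × β => g p - m p.2 := hg.sub (hmm.comp measurable_snd)
  have db : ∀ p : α × β, |g p - m p.2| ≤ M + M := fun p =>
    (abs_sub _ _).trans (add_le_add (hb p) (hmb _))
  have d2i := integrable_of_abs_le (ν := ν.prod ρ) (dm.pow_const 2)
    fun p => abs_sq_le_of_abs_le (db p)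
  have hcm : Measurable fun x => h x - ∫ x, h x ∂ν := hhm.sub_const _
  have hcb : ∀ x, |h x - ∫ x, h x ∂ν| ≤ M + M := fun x =>
    (abs_sub _ _).trans (add_le_add (hhb x) (abs_integral_le_of_abs_le hhb))
  -- Averaging in one variable decreases the variance in the other: `h x - ∫ h` is the `ρ`-mean of
  -- `g (x, y) - m y`, so Jensen applies. Adding `G1` and `G2` then gives the claim.
  have G3 : ∫ x, h x ^ 2 ∂ν - (∫ x, h x ∂ν) ^ 2 ≤
      ∫ p, g p ^ 2 ∂(ν.prod ρ) - ∫ y, m y ^ 2 ∂ρ := by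
    calc ∫ x, h x ^ 2 ∂ν - (∫ x, h x ∂ν) ^ 2 = ∫ x, (h x - ∫ x, h x ∂ν) ^ 2 ∂ν :=
          (integral_sub_const_sq hhm hhb).symm
      _ ≤ ∫ x, ∫ y, (g (x, y) - m y) ^ 2 ∂ρ ∂ν := by
          refine integral_mono (integrable_of_abs_le (hcm.pow_const 2)
            fun x => abs_sq_le_of_abs_le (hcb x)) d2i.integral_prod_left fun x => ?_
          have := sq_integral_le_integral_sq (ν := ρ) (φ := fun y => g (x, y) - m y)
            ((hgx x).sub hmm) (fun y => db (x, y))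
          rw [integral_sub (integrable_of_abs_le (hgx x) fun y => hb _)
            (integrable_of_abs_le hmm hmb), ← e2, e1] at this
          exact this
      _ = ∫ y, ∫ x, (g (x, y) - m y) ^ 2 ∂ν ∂ρ := by
          rw [← integral_prod _ d2i, integral_prod_symm _ d2i]
      _ = ∫ y, (∫ x, g (x, y) ^ 2 ∂ν - m y ^ 2) ∂ρ :=
          integral_congr_ae (ae_of_all _ fun y => integral_sub_const_sq (hgy y) fun x => hb _)
      _ = _ := by
          rw [integral_sub g2i.integral_prod_right m2i, integral_prod_symm _ g2i]
  rw [e1] at *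
  linarith

lemma integral_pi_fin_succ {n : ℕ} (ν : Measure ℝ) [IsProbabilityMeasure ν]
    (φ : (Fin (n + 1) → ℝ) → ℝ) :
    ∫ x, φ x ∂(Measure.pi fun _ => ν) =
      ∫ p : ℝ × (Fin n → ℝ), φ (Fin.cons p.1 p.2) ∂(ν.prod (Measure.pi fun _ => ν)) := by
  rw [← ((measurePreserving_piFinSuccAbove (fun _ : Fin (n + 1) => ν) 0).symm).integral_comp']
  simp [MeasurableEquiv.piFinSuccAbove_symm_apply, Fin.insertNthEquiv]

lemma measurable_finCons {n : ℕ} :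
    Measurable fun p : ℝ × (Fin n → ℝ) => (Fin.cons p.1 p.2 : Fin (n + 1) → ℝ) := by
  refine measurable_pi_lambda _ fun i => ?_
  refine Fin.cases ?_ (fun j => ?_) i
  · simpa using measurable_fst
  · simpa [Function.comp_def] using (measurable_pi_apply j).comp measurable_snd

/-- Tensorization of inequalities of Poincaré type: one-dimensional bounds for the variance along
each coordinate add up to a bound for the variance under the product measure. -/
lemma pi_variance_le (ν : Measure ℝ) [IsProbabilityMeasure ν] {M M' : ℝ} {n : ℕ}
    {g : (Fin n → ℝ) → ℝ} {D : Fin n → (Fin n → ℝ) → ℝ} (hg : Measurable g)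
    (hb : ∀ x, |g x| ≤ M) (hD : ∀ i, Measurable (D i)) (hDb : ∀ i x, |D i x| ≤ M')
    (H : ∀ i x, ∫ t, g (Function.update x i t) ^ 2 ∂ν - (∫ t, g (Function.update x i t) ∂ν) ^ 2 ≤
      ∫ t, D i (Function.update x i t) ∂ν) :
    ∫ x, g x ^ 2 ∂(Measure.pi fun _ => ν) - (∫ x, g x ∂(Measure.pi fun _ => ν)) ^ 2 ≤
      ∑ i, ∫ x, D i x ∂(Measure.pi fun _ => ν) := by
  induction n with
  | zero =>
    rw [show g = fun _ => g 0 from funext fun x => congrArg g (Subsingleton.elim _ _)]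
    simp
  | succ n ih =>
    set ρ : Measure (Fin n → ℝ) := Measure.pi fun _ => ν
    have hDc : ∀ i, Measurable fun p : ℝ × (Fin n → ℝ) => D i (Fin.cons p.1 p.2) :=
      fun i => (hD i).comp measurable_finCons
    have hDi : ∀ i, Integrable (fun p : ℝ × (Fin n → ℝ) => D i (Fin.cons p.1 p.2)) (ν.prod ρ) :=
      fun i => integrable_of_abs_le (hDc i) fun p => hDb i _
    have key := prod_variance_le (ν := ν) (ρ := ρ)
      (g := fun p : ℝ × (Fin n → ℝ) => g (Fin.cons p.1 p.2))
      (A := fun x => ∑ i : Fin n, ∫ y, D i.succ (Fin.cons x y) ∂ρ)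
      (B := fun y => ∫ t, D 0 (Fin.cons t y) ∂ν)
      (hg.comp measurable_finCons) (fun p => hb _)
      (integrable_finsetSum _ fun i _ => (hDi i.succ).integral_prod_left)
      (hDi 0).integral_prod_right
      (fun x => ih (g := fun y => g (Fin.cons x y)) (D := fun i y => D i.succ (Fin.cons x y))
        (hg.comp (measurable_finCons.comp measurable_prodMk_left)) (fun y => hb _)
        (fun i => (hD _).comp (measurable_finCons.comp measurable_prodMk_left))
        (fun i y => hDb _ _)
        (fun i y => by simpa [← Fin.cons_update] using H i.succ (Fin.cons x y)))
      (fun y => by simpa using H 0 (Fin.cons 0 y))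
    rw [integral_pi_fin_succ, integral_pi_fin_succ, Fin.sum_univ_succ]
    refine key.trans (le_of_eq ?_)
    rw [integral_finsetSum _ fun i _ => (hDi i.succ).integral_prod_left, add_comm]
    congr 1
    · rw [integral_pi_fin_succ, integral_prod_symm _ (hDi 0)]
    · refine Finset.sum_congr rfl fun i _ => ?_
      rw [integral_pi_fin_succ, integral_prod _ (hDi i.succ)]

/-! ### The product measure and exponentials of Lipschitz functions -/

lemma pi_laplaceMeasure (n : ℕ) :
    (Measure.pi fun _ : Fin n => laplaceMeasure) =
      (volume : Measure (Fin n → ℝ)).withDensity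
        fun x => ENNReal.ofReal ((2 : ℝ)⁻¹ ^ n * Real.exp (-∑ i, |x i|)) := by
  have hdens : ∀ x : Fin n → ℝ,
      (2 : ℝ)⁻¹ ^ n * Real.exp (-∑ i, |x i|) = ∏ i, laplaceDensity (x i) := by
    intro x
    simp [laplaceDensity, Finset.prod_mul_distrib, ← Real.exp_sum]
  simp_rw [hdens]
  refine Measure.pi_eq fun s hs => ?_
  rw [withDensity_apply _ (MeasurableSet.univ_pi hs), volume_pi, Measure.restrict_pi_pi,
    ← ofReal_integral_eq_lintegral_ofReal
      (Integrable.fintype_prod fun i => integrable_laplaceDensity.restrict)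
      (ae_of_all _ fun x => Finset.prod_nonneg fun i _ => laplaceDensity_nonneg _),
    integral_fintype_prod_eq_prod,
    ENNReal.ofReal_prod_of_nonneg fun i _ => integral_nonneg fun x => laplaceDensity_nonneg x]
  refine Finset.prod_congr rfl fun i _ => ?_
  rw [laplaceMeasure, withDensity_apply _ (hs i), ofReal_integral_eq_lintegral_ofReal
    integrable_laplaceDensity.restrict (ae_of_all _ laplaceDensity_nonneg)]

/-- The two-sided product exponential measure is the product of its one-dimensional marginals. -/
lemma measurePreserving_toLp_pi_laplaceMeasure (n : ℕ) :
    MeasurePreserving (WithLp.toLp 2) (Measure.pi fun _ : Fin n => laplaceMeasure)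
      (twoSidedExp n) := by
  refine ⟨(MeasurableEquiv.toLp 2 (Fin n → ℝ)).measurable, ?_⟩
  ext s hs
  have hm : Measurable (WithLp.toLp 2 : (Fin n → ℝ) → EuclideanSpace ℝ (Fin n)) :=
    (MeasurableEquiv.toLp 2 (Fin n → ℝ)).measurable
  rw [pi_laplaceMeasure, Measure.map_apply hm hs, withDensity_apply _ (hm hs), twoSidedExp,
    withDensity_apply _ hs]
  exact (PiLp.volume_preserving_toLp (Fin n)).setLIntegral_comp_preimage_emb
    (MeasurableEquiv.toLp 2 (Fin n → ℝ)).measurableEmbedding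
    (fun x => ENNReal.ofReal ((2 : ℝ)⁻¹ ^ n * Real.exp (-∑ i, |x i|))) s

instance (n : ℕ) : IsProbabilityMeasure (twoSidedExp n) := by
  have mp := measurePreserving_toLp_pi_laplaceMeasure n
  rw [← mp.map_eq]
  exact Measure.isProbabilityMeasure_map mp.measurable.aemeasurable

lemma abs_exp_sub_exp_le {a b R : ℝ} (ha : a ≤ R) (hb : b ≤ R) :
    |Real.exp a - Real.exp b| ≤ Real.exp R * |a - b| := by
  wlog h : b ≤ a generalizing a b
  · rw [abs_sub_comm, abs_sub_comm a]; exact this hb ha (le_of_not_ge h)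
  rw [abs_of_nonneg (sub_nonneg.2 (Real.exp_le_exp.2 h)), abs_of_nonneg (sub_nonneg.2 h)]
  have h1 : Real.exp a * (1 - Real.exp (b - a)) = Real.exp a - Real.exp b := by
    rw [mul_sub, ← Real.exp_add]; simp
  rw [← h1]
  have h2 := Real.add_one_le_exp (b - a)
  calc Real.exp a * (1 - Real.exp (b - a)) ≤ Real.exp a * (a - b) :=
        mul_le_mul_of_nonneg_left (by linarith) (Real.exp_pos a).le
    _ ≤ Real.exp R * (a - b) :=
        mul_le_mul_of_nonneg_right (Real.exp_le_exp.2 ha) (sub_nonneg.2 h)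

lemma lipschitzWith_toLp_update {n : ℕ} (x : Fin n → ℝ) (i : Fin n) :
    LipschitzWith 1 fun t : ℝ => (WithLp.toLp 2 (Function.update x i t) :
      EuclideanSpace ℝ (Fin n)) := by
  refine LipschitzWith.of_dist_le_mul fun s t => ?_
  rw [EuclideanSpace.dist_eq, Finset.sum_eq_single i]
  · simp [Real.sqrt_sq dist_nonneg]
  · intro j _ hj
    simp [Function.update_of_ne hj]
  · simp

/-- The partial derivatives are the coordinates of the gradient. Testing the derivative, of norm at
most 1, on the gradient `v` gives `‖v‖² ≤ ‖v‖`. -/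
lemma sum_sq_deriv_le_one {n : ℕ} {f : EuclideanSpace ℝ (Fin n) → ℝ} (hf : LipschitzWith 1 f)
    {x : Fin n → ℝ} (hd : DifferentiableAt ℝ f (WithLp.toLp 2 x)) :
    (∀ i, DifferentiableAt ℝ (fun t => f (WithLp.toLp 2 (Function.update x i t))) (x i)) ∧
    ∑ i, deriv (fun t => f (WithLp.toLp 2 (Function.update x i t))) (x i) ^ 2 ≤ 1 := by
  set L := fderiv ℝ f (WithLp.toLp 2 x) with hL
  have h1 : ∀ i, HasDerivAt (fun t => f (WithLp.toLp 2 (Function.update x i t)))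
      (L (EuclideanSpace.single i 1)) (x i) := by
    intro i
    have hu : HasDerivAt (fun t => (WithLp.toLp 2 (Function.update x i t) :
        EuclideanSpace ℝ (Fin n))) (EuclideanSpace.single i 1) (x i) := by
      have h := (hasDerivAt_update x i (x i))
      have := (PiLp.continuousLinearEquiv 2 ℝ (fun _ : Fin n => ℝ)).symm.hasFDerivAt.comp_hasDerivAt
        (x i) h
      exact this
    have hd' : HasFDerivAt f L (WithLp.toLp 2 (Function.update x i (x i))) := by
      rw [Function.update_eq_self]; exact hd.hasFDerivAt
    exact hd'.comp_hasDerivAt (x i) hu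
  refine ⟨fun i => (h1 i).differentiableAt, ?_⟩
  simp_rw [fun i => (h1 i).deriv]
  set S := ∑ i, L (EuclideanSpace.single i 1) ^ 2 with hS
  have hS0 : 0 ≤ S := Finset.sum_nonneg fun i _ => sq_nonneg _
  set v : EuclideanSpace ℝ (Fin n) := WithLp.toLp 2 fun i => L (EuclideanSpace.single i 1) with hv
  have h2 : L v = S := by
    have : v = ∑ i, L (EuclideanSpace.single i 1) • EuclideanSpace.single i (1 : ℝ) := by
      ext j
      simp [hv, Pi.single_apply]
    conv_lhs => rw [this]
    simp [hS, sq]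
  have h3 : ‖v‖ = Real.sqrt S := by
    rw [EuclideanSpace.norm_eq]
    simp [hv, hS]
  have h4 : ‖L‖ ≤ 1 := by simpa using norm_fderiv_le_of_lipschitz ℝ hf (x₀ := WithLp.toLp 2 x)
  have h5 : S ≤ Real.sqrt S := by
    calc S = L v := h2.symm
      _ ≤ ‖L v‖ := Real.le_norm_self _
      _ ≤ ‖L‖ * ‖v‖ := L.le_opNorm v
      _ ≤ 1 * ‖v‖ := by gcongr
      _ = Real.sqrt S := by rw [one_mul, h3]
  have h6 := Real.sq_sqrt hS0
  nlinarith [Real.sqrt_nonneg S, sq_nonneg (Real.sqrt S - 1)]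

/-- The Poincaré inequality applied to `exp (s f / 2)`. -/
lemma integral_exp_sub_sq_le {n : ℕ} {f : EuclideanSpace ℝ (Fin n) → ℝ} (hf : LipschitzWith 1 f)
    {N : ℝ} (hN : ∀ x, |f x| ≤ N) (s : ℝ) :
    ∫ x, Real.exp (s * f x) ∂(twoSidedExp n) -
        (∫ x, Real.exp (s / 2 * f x) ∂(twoSidedExp n)) ^ 2 ≤
      s ^ 2 * ∫ x, Real.exp (s * f x) ∂(twoSidedExp n) := by
  have mp := measurePreserving_toLp_pi_laplaceMeasure n
  have hcont : Continuous (WithLp.toLp 2 : (Fin n → ℝ) → EuclideanSpace ℝ (Fin n)) :=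
    PiLp.continuous_toLp 2 _
  have me : MeasurableEmbedding (WithLp.toLp 2 : (Fin n → ℝ) → EuclideanSpace ℝ (Fin n)) :=
    (MeasurableEquiv.toLp 2 (Fin n → ℝ)).measurableEmbedding
  rw [← mp.integral_comp me, ← mp.integral_comp me]
  set F : (Fin n → ℝ) → ℝ := fun x => f (WithLp.toLp 2 x) with hF
  have hFc : Continuous F := hf.continuous.comp hcont
  set g : (Fin n → ℝ) → ℝ := fun x => Real.exp (s / 2 * F x) with hg
  have hgc : Continuous g := by fun_prop
  set R := |s / 2| * N with hR
  have hsR : ∀ y, s / 2 * f y ≤ R := fun y => by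
    refine (le_abs_self _).trans ?_
    rw [abs_mul]
    exact mul_le_mul_of_nonneg_left (hN y) (abs_nonneg _)
  have hgb : ∀ x, |g x| ≤ Real.exp R := fun x => by
    rw [abs_of_pos (Real.exp_pos _)]
    exact Real.exp_le_exp.2 (hsR _)
  set K : NNReal := Real.toNNReal (Real.exp R * |s / 2|) with hK
  have hKc : (K : ℝ) = Real.exp R * |s / 2| := Real.coe_toNNReal _ (by positivity)
  have hgL : ∀ i (x : Fin n → ℝ), LipschitzWith K fun t => g (Function.update x i t) := by
    intro i x
    refine LipschitzWith.of_dist_le_mul fun a b => ?_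
    have h1 := (hf.comp (lipschitzWith_toLp_update x i)).dist_le_mul a b
    simp only [mul_one, NNReal.coe_one, one_mul, Function.comp_apply] at h1
    rw [hKc]
    refine (abs_exp_sub_exp_le (hsR _) (hsR _)).trans ?_
    rw [← mul_sub, abs_mul, mul_assoc]
    gcongr
    exact h1
  -- The factor 4 is the one-dimensional Poincaré constant; it cancels the square of `s / 2` from
  -- the chain rule, leaving `s ^ 2`.
  set D : Fin n → (Fin n → ℝ) → ℝ := fun i x =>
    4 * deriv (fun t => g (Function.update x i t)) (x i) ^ 2 with hD
  have hDm : ∀ i, Measurable (D i) := by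
    intro i
    have h1 : Measurable fun p : (Fin n → ℝ) × ℝ =>
        deriv (fun t => g (Function.update p.1 i t)) p.2 :=
      measurable_deriv_with_param (f := fun (x : Fin n → ℝ) t => g (Function.update x i t))
        (hgc.comp (continuous_fst.update i continuous_snd))
    exact ((h1.comp (measurable_id.prodMk (measurable_pi_apply i))).pow_const 2).const_mul 4
  have hDb : ∀ i x, |D i x| ≤ 4 * (K : ℝ) ^ 2 := by
    intro i x
    rw [abs_mul, abs_of_pos (by norm_num : (0 : ℝ) < 4)]
    exact mul_le_mul_of_nonneg_left
      (abs_sq_le_of_abs_le (norm_deriv_le_of_lipschitz (hgL i x))) (by norm_num)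
  have key := pi_variance_le laplaceMeasure hgc.measurable hgb hDm hDb (fun i x => by
    simp only [hD, Function.update_idem, Function.update_self, integral_const_mul]
    exact laplaceMeasure_poincare (hgL i x) fun t => hgb _)
  have hg2 : ∀ x, g x ^ 2 = Real.exp (s * F x) := fun x => by
    rw [hg, ← Real.exp_nat_mul]; congr 1; push_cast; ring
  simp_rw [hg2] at key
  refine key.trans ?_
  rw [← integral_finsetSum _ fun i _ => integrable_of_abs_le (hDm i) (hDb i), ← integral_const_mul]
  refine integral_mono_ae (integrable_finsetSum _ fun i _ => integrable_of_abs_le (hDm i) (hDb i))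
    ((integrable_of_abs_le (hgc.pow 2).measurable fun x => abs_sq_le_of_abs_le (hgb x)).congr
      (ae_of_all _ hg2) |>.const_mul _) ?_
  -- Rademacher's theorem, transferred through absolute continuity.
  have hac : ∀ᵐ y ∂(twoSidedExp n), DifferentiableAt ℝ f y :=
    (withDensity_absolutelyContinuous _ _).ae_le hf.ae_differentiableAt
  filter_upwards [mp.quasiMeasurePreserving.ae hac] with x hx
  obtain ⟨h1, h2⟩ := sum_sq_deriv_le_one hf hx
  have h3 : ∀ i, D i x = s ^ 2 * Real.exp (s * F x) *
      deriv (fun t => f (WithLp.toLp 2 (Function.update x i t))) (x i) ^ 2 := by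
    intro i
    have := ((h1 i).hasDerivAt.const_mul (s / 2)).exp.deriv
    simp only [hD, hg, hF]
    rw [this, Function.update_eq_self, ← hg2]
    simp only [hg, hF]
    ring
  simp_rw [h3, ← Finset.mul_sum]
  exact mul_le_of_le_one_right (by positivity) h2

/-! ### Dimension-free exponential concentration -/

lemma integrable_exp_mul_of_abs_le {α : Type*} [MeasurableSpace α] {μ : Measure α}
    [IsFiniteMeasure μ] {f : α → ℝ} (hf : Measurable f) {N : ℝ} (hN : ∀ x, |f x| ≤ N) (s : ℝ) :
    Integrable (fun x => Real.exp (s * f x)) μ := by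
  refine integrable_of_abs_le (by fun_prop) (M := Real.exp (|s| * N)) fun x => ?_
  rw [abs_of_pos (Real.exp_pos _)]
  refine Real.exp_le_exp.2 ((le_abs_self _).trans ?_)
  rw [abs_mul]
  exact mul_le_mul_of_nonneg_left (hN x) (abs_nonneg _)

/-- Base case of the dyadic iteration. Symmetrized, the product is the double integral of `cosh (s
(f x - f y))`, and `cosh t ≤ exp (t² / 2)` with `|f x - f y| ≤ 2N`. That the exponent is quadratic
in `s` is what lets the iteration eliminate `N`. -/
lemma integral_exp_mul_integral_exp_neg_le {α : Type*} [MeasurableSpace α] {μ : Measure α}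
    [IsProbabilityMeasure μ] {f : α → ℝ} (hf : Measurable f) {N : ℝ} (hN : ∀ x, |f x| ≤ N)
    (s : ℝ) :
    (∫ x, Real.exp (s * f x) ∂μ) * ∫ x, Real.exp (-s * f x) ∂μ ≤
      Real.exp (2 * N ^ 2 * s ^ 2) := by
  have i1 := integrable_exp_mul_of_abs_le (μ := μ) hf hN s
  have i2 := integrable_exp_mul_of_abs_le (μ := μ) hf hN (-s)
  have e1 := integral_prod_mul (μ := μ) (ν := μ) (fun x => Real.exp (s * f x))
    (fun x => Real.exp (-s * f x))
  have e2 := integral_prod_mul (μ := μ) (ν := μ) (fun x => Real.exp (-s * f x))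
    (fun x => Real.exp (s * f x))
  have h : ∫ p, Real.exp (s * f p.1) * Real.exp (-s * f p.2) +
      Real.exp (-s * f p.1) * Real.exp (s * f p.2) ∂(μ.prod μ) ≤
      ∫ _p, 2 * Real.exp (2 * N ^ 2 * s ^ 2) ∂(μ.prod μ) := by
    refine integral_mono ((i1.mul_prod i2).add (i2.mul_prod i1)) (integrable_const _) fun p => ?_
    have h1 := Real.cosh_le_exp_half_sq (s * (f p.1 - f p.2))
    rw [Real.cosh_eq] at h1
    have h2 : (s * (f p.1 - f p.2)) ^ 2 / 2 ≤ 2 * N ^ 2 * s ^ 2 := by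
      have : (f p.1 - f p.2) ^ 2 ≤ (2 * N) ^ 2 := by
        refine sq_le_sq' ?_ ?_ <;> linarith [abs_le.1 (hN p.1), abs_le.1 (hN p.2)]
      nlinarith [sq_nonneg s]
    have h3 := Real.exp_le_exp.2 h2
    simp only [← Real.exp_add]
    have h4 : s * f p.1 + -s * f p.2 = s * (f p.1 - f p.2) := by ring
    have h5 : -s * f p.1 + s * f p.2 = -(s * (f p.1 - f p.2)) := by ring
    rw [h4, h5]
    linarith
  rw [integral_add (i1.mul_prod i2) (i2.mul_prod i1), e1, e2] at h
  simp only [integral_const, probReal_univ, one_smul] at h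
  linarith

/-- Iterating the Poincaré inequality along dyadic scales. -/
lemma twoSidedExp_laplace_le_aux {n : ℕ} {f : EuclideanSpace ℝ (Fin n) → ℝ}
    (hf : LipschitzWith 1 f) {N : ℝ} (hN : ∀ x, |f x| ≤ N) (k : ℕ) :
    ∀ s : ℝ, 0 ≤ s → s ≤ 1 / 2 →
      (∫ x, Real.exp (s * f x) ∂(twoSidedExp n)) * ∫ x, Real.exp (-s * f x) ∂(twoSidedExp n) ≤
        Real.exp (8 * s ^ 2 * (1 - (1 / 2) ^ k) + 2 * N ^ 2 * s ^ 2 * (1 / 2) ^ k) := by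
  induction k with
  | zero =>
    intro s _ _
    simpa using integral_exp_mul_integral_exp_neg_le hf.continuous.measurable hN s
  | succ k ih =>
    intro s hs0 hs
    have p1 := integral_exp_sub_sq_le hf hN s
    have p2 := integral_exp_sub_sq_le hf hN (-s)
    have p3 := ih (s / 2) (by linarith) (by linarith)
    rw [← neg_div] at p3
    have n1 : 0 ≤ ∫ x, Real.exp (s * f x) ∂(twoSidedExp n) :=
      integral_nonneg fun x => (Real.exp_pos _).le
    have n2 : 0 ≤ ∫ x, Real.exp (-s * f x) ∂(twoSidedExp n) :=
      integral_nonneg fun x => (Real.exp_pos _).le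
    have n3 : 0 ≤ ∫ x, Real.exp (s / 2 * f x) ∂(twoSidedExp n) :=
      integral_nonneg fun x => (Real.exp_pos _).le
    have n4 : 0 ≤ ∫ x, Real.exp (-s / 2 * f x) ∂(twoSidedExp n) :=
      integral_nonneg fun x => (Real.exp_pos _).le
    set a := ∫ x, Real.exp (s * f x) ∂(twoSidedExp n)
    set b := ∫ x, Real.exp (-s * f x) ∂(twoSidedExp n)
    set c := ∫ x, Real.exp (s / 2 * f x) ∂(twoSidedExp n)
    set d := ∫ x, Real.exp (-s / 2 * f x) ∂(twoSidedExp n)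
    set E := 8 * (s / 2) ^ 2 * (1 - (1 / 2) ^ k) + 2 * N ^ 2 * (s / 2) ^ 2 * (1 / 2) ^ k with hE
    have hs2 : s ^ 2 ≤ 1 / 4 := by nlinarith
    -- `(1 + 2s²)(1 - s²) ≥ 1` because `s² ≤ 1/4`; thus the loss `(1 - s²)⁻¹` is at most `e^{2s²}`.
    have q1 : 1 ≤ Real.exp (2 * s ^ 2) * (1 - s ^ 2) := by
      have := Real.add_one_le_exp (2 * s ^ 2)
      nlinarith [sq_nonneg s]
    have q2 : a ≤ Real.exp (2 * s ^ 2) * c ^ 2 := by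
      calc a ≤ Real.exp (2 * s ^ 2) * (1 - s ^ 2) * a := le_mul_of_one_le_left n1 q1
        _ = Real.exp (2 * s ^ 2) * ((1 - s ^ 2) * a) := by ring
        _ ≤ _ := mul_le_mul_of_nonneg_left (by linarith) (Real.exp_pos _).le
    have q3 : b ≤ Real.exp (2 * s ^ 2) * d ^ 2 := by
      rw [neg_sq] at p2
      calc b ≤ Real.exp (2 * s ^ 2) * (1 - s ^ 2) * b := le_mul_of_one_le_left n2 q1
        _ = Real.exp (2 * s ^ 2) * ((1 - s ^ 2) * b) := by ring
        _ ≤ _ := mul_le_mul_of_nonneg_left (by linarith) (Real.exp_pos _).le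
    calc a * b ≤ (Real.exp (2 * s ^ 2) * c ^ 2) * (Real.exp (2 * s ^ 2) * d ^ 2) :=
          mul_le_mul q2 q3 n2 (by positivity)
      _ = Real.exp (4 * s ^ 2) * (c * d) ^ 2 := by
          rw [show 4 * s ^ 2 = 2 * s ^ 2 + 2 * s ^ 2 by ring, Real.exp_add]; ring
      _ ≤ Real.exp (4 * s ^ 2) * Real.exp E ^ 2 :=
          mul_le_mul_of_nonneg_left (pow_le_pow_left₀ (mul_nonneg n3 n4) p3 2) (Real.exp_pos _).le
      _ = Real.exp (4 * s ^ 2 + 2 * E) := by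
          rw [← Real.exp_nat_mul, ← Real.exp_add]; norm_num
      _ ≤ _ := by
          -- Halving `s` and squaring halves a quadratic exponent: the `N²` term is halved, and `8`
          -- is the fixed point of `C ↦ 4 + C / 2`.
          refine Real.exp_le_exp.2 (le_of_eq ?_)
          rw [hE, pow_succ]; ring

lemma twoSidedExp_laplace_le {n : ℕ} {f : EuclideanSpace ℝ (Fin n) → ℝ}
    (hf : LipschitzWith 1 f) {N : ℝ} (hN : ∀ x, |f x| ≤ N) :
    (∫ x, Real.exp (1 / 2 * f x) ∂(twoSidedExp n)) *
      ∫ x, Real.exp (-(1 / 2) * f x) ∂(twoSidedExp n) ≤ Real.exp 2 := by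
  have ht : Filter.Tendsto (fun k : ℕ => ((1 : ℝ) / 2) ^ k) Filter.atTop (nhds 0) :=
    tendsto_pow_atTop_nhds_zero_of_lt_one (by norm_num) (by norm_num)
  have hl : Filter.Tendsto (fun k : ℕ => Real.exp (8 * (1 / 2) ^ 2 * (1 - (1 / 2) ^ k) +
      2 * N ^ 2 * (1 / 2) ^ 2 * (1 / 2) ^ k)) Filter.atTop
      (nhds (Real.exp (8 * (1 / 2) ^ 2 * (1 - 0) + 2 * N ^ 2 * (1 / 2) ^ 2 * 0))) :=
    (Real.continuous_exp.tendsto _).comp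
      (((ht.const_sub 1).const_mul _).add (ht.const_mul _))
  have := ge_of_tendsto' hl fun k =>
    twoSidedExp_laplace_le_aux hf hN k (1 / 2) (by norm_num) le_rfl
  norm_num at this ⊢
  exact this

/-- The bound for bounded functions does not involve `N`, so it applies to the truncations of `f` at
height `k` and passes to the limit by Fatou. -/
lemma lintegral_prod_exp_le {n : ℕ} {f : EuclideanSpace ℝ (Fin n) → ℝ} (hf : LipschitzWith 1 f) :
    ∫⁻ p, ENNReal.ofReal (Real.exp ((f p.1 - f p.2) / 2)) ∂((twoSidedExp n).prod (twoSidedExp n)) ≤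
      ENNReal.ofReal (Real.exp 2) := by
  set T : ℕ → EuclideanSpace ℝ (Fin n) → ℝ := fun k x => max (-(k : ℝ)) (min (f x) k) with hT
  have hTL : ∀ k, LipschitzWith 1 (T k) := fun k => (hf.min_const _).const_max _
  have hTb : ∀ k x, |T k x| ≤ k := fun k x => by
    have : (0 : ℝ) ≤ k := k.cast_nonneg
    exact abs_le.2 ⟨le_max_left _ _, max_le (by linarith) (min_le_right _ _)⟩
  have hTc : ∀ k, Continuous (T k) := fun k => (hTL k).continuous
  have hev : ∀ x, ∀ᶠ k : ℕ in Filter.atTop, T k x = f x := fun x => by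
    obtain ⟨k₀, hk₀⟩ := exists_nat_ge |f x|
    filter_upwards [Filter.eventually_ge_atTop k₀] with k hk
    have h1 : |f x| ≤ k := hk₀.trans (Nat.cast_le.2 hk)
    rw [hT]
    simp only
    rw [min_eq_left (abs_le.1 h1).2, max_eq_right (abs_le.1 h1).1]
  have hlim : ∀ p : EuclideanSpace ℝ (Fin n) × EuclideanSpace ℝ (Fin n),
      Filter.liminf (fun k => ENNReal.ofReal (Real.exp ((T k p.1 - T k p.2) / 2))) Filter.atTop =
        ENNReal.ofReal (Real.exp ((f p.1 - f p.2) / 2)) := fun p => by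
    refine Filter.Tendsto.liminf_eq (tendsto_const_nhds.congr' ?_)
    filter_upwards [hev p.1, hev p.2] with k h1 h2
    rw [h1, h2]
  simp_rw [← hlim]
  refine (lintegral_liminf_le fun k => ?_).trans (Filter.liminf_le_of_le (by isBoundedDefault) ?_)
  · have := hTc k
    fun_prop
  intro b hb
  obtain ⟨k, hk⟩ := hb.exists
  refine hk.trans ?_
  have i1 := integrable_exp_mul_of_abs_le (μ := twoSidedExp n) (hTc k).measurable (hTb k) (1 / 2)
  have i2 := integrable_exp_mul_of_abs_le (μ := twoSidedExp n) (hTc k).measurable (hTb k)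
    (-(1 / 2))
  have e : ∀ p : EuclideanSpace ℝ (Fin n) × EuclideanSpace ℝ (Fin n),
      Real.exp ((T k p.1 - T k p.2) / 2) =
        Real.exp (1 / 2 * T k p.1) * Real.exp (-(1 / 2) * T k p.2) := fun p => by
    rw [← Real.exp_add]; ring_nf
  simp_rw [e]
  rw [← ofReal_integral_eq_lintegral_ofReal (i1.mul_prod i2)
    (ae_of_all _ fun p => by positivity)]
  refine ENNReal.ofReal_le_ofReal ?_
  rw [integral_prod_mul (fun x => Real.exp (1 / 2 * T k x))
    (fun x => Real.exp (-(1 / 2) * T k x))]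
  exact twoSidedExp_laplace_le (hTL k) (hTb k)

/-- Dimension-free exponential concentration of Lipschitz functions under the two-sided product
exponential measure. -/
lemma exists_lintegral_exp_abs_sub_le {n : ℕ} {f : EuclideanSpace ℝ (Fin n) → ℝ}
    (hf : LipschitzWith 1 f) :
    ∃ m : ℝ, ∫⁻ x, ENNReal.ofReal (Real.exp (|f x - m| / 2)) ∂(twoSidedExp n) ≤
      ENNReal.ofReal (Real.exp 3) := by
  have hc := hf.continuous
  have h1 := lintegral_prod_exp_le hf
  have h2 := lintegral_prod_exp_le (f := fun x => -f x) hf.neg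
  have h3 : ∫⁻ p, ENNReal.ofReal (Real.exp (|f p.1 - f p.2| / 2))
      ∂((twoSidedExp n).prod (twoSidedExp n)) ≤ ENNReal.ofReal (Real.exp 3) := by
    calc _ ≤ ∫⁻ p, (ENNReal.ofReal (Real.exp ((f p.1 - f p.2) / 2)) +
          ENNReal.ofReal (Real.exp ((-f p.1 - -f p.2) / 2)))
            ∂((twoSidedExp n).prod (twoSidedExp n)) := by
          refine lintegral_mono fun p => ?_
          rw [← ENNReal.ofReal_add (Real.exp_pos _).le (Real.exp_pos _).le]
          refine ENNReal.ofReal_le_ofReal ?_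
          rcases abs_cases (f p.1 - f p.2) with ⟨h, _⟩ | ⟨h, _⟩ <;> rw [h]
          · exact le_add_of_nonneg_right (Real.exp_pos _).le
          · rw [show -(f p.1 - f p.2) = -f p.1 - -f p.2 by ring]
            exact le_add_of_nonneg_left (Real.exp_pos _).le
      _ ≤ ENNReal.ofReal (Real.exp 2) + ENNReal.ofReal (Real.exp 2) := by
          rw [lintegral_add_left (by fun_prop)]
          exact add_le_add h1 h2
      _ ≤ ENNReal.ofReal (Real.exp 3) := by
          rw [← ENNReal.ofReal_add (Real.exp_pos _).le (Real.exp_pos _).le]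
          refine ENNReal.ofReal_le_ofReal ?_
          rw [show (3 : ℝ) = 2 + 1 by norm_num, Real.exp_add]
          nlinarith [Real.exp_pos 2, Real.add_one_le_exp 1]
  rw [lintegral_prod_symm' _ (by fun_prop)] at h3
  -- Some `y` does no worse than the average over `y`; the centre is `m = f y`.
  obtain ⟨y, hy⟩ := exists_le_lintegral (μ := twoSidedExp n)
    (f := fun y => ∫⁻ x, ENNReal.ofReal (Real.exp (|f x - f y| / 2)) ∂(twoSidedExp n))
    (Measurable.lintegral_prod_left' (f := fun p : EuclideanSpace ℝ (Fin n) ×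
      EuclideanSpace ℝ (Fin n) => ENNReal.ofReal (Real.exp (|f p.1 - f p.2| / 2)))
      (by fun_prop)).aemeasurable
  exact ⟨f y, hy.trans h3⟩

/-! ### From exponential moments to a `ψ₁` bound -/

lemma integrable_exp_of_lintegral_le {α : Type*} [MeasurableSpace α] {ν : Measure α}
    {Y : α → ℝ} (hY : Measurable Y) {S : ℝ}
    (h : ∫⁻ x, ENNReal.ofReal (Real.exp (Y x)) ∂ν ≤ ENNReal.ofReal (Real.exp S)) :
    Integrable (fun x => Real.exp (Y x)) ν ∧ ∫ x, Real.exp (Y x) ∂ν ≤ Real.exp S := by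
  have hi : Integrable (fun x => Real.exp (Y x)) ν := by
    refine ⟨by fun_prop, ?_⟩
    rw [hasFiniteIntegral_iff_ofReal (ae_of_all _ fun x => (Real.exp_pos _).le)]
    exact h.trans_lt ENNReal.ofReal_lt_top
  refine ⟨hi, ?_⟩
  rw [← ofReal_integral_eq_lintegral_ofReal hi (ae_of_all _ fun x => (Real.exp_pos _).le)] at h
  exact (ENNReal.ofReal_le_ofReal_iff (Real.exp_pos _).le).1 h

lemma integrable_of_lintegral_exp_le {α : Type*} [MeasurableSpace α] {ν : Measure α}
    [IsFiniteMeasure ν] {F : α → ℝ} (hF : Measurable F) {m S : ℝ}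
    (h : ∫⁻ x, ENNReal.ofReal (Real.exp (|F x - m| / 2)) ∂ν ≤ ENNReal.ofReal (Real.exp S)) :
    Integrable F ν := by
  have hi := (integrable_exp_of_lintegral_le (by fun_prop) h).1
  have h1 : Integrable (fun x => F x - m) ν := by
    refine (hi.const_mul 2).mono' (by fun_prop) (ae_of_all _ fun x => ?_)
    rw [Real.norm_eq_abs]
    linarith [Real.add_one_le_exp (|F x - m| / 2)]
  exact (h1.add (integrable_const m)).congr (ae_of_all _ fun x => sub_add_cancel _ _)

lemma exp_mul_le_of_le_one {q : ℝ} (h0 : 0 ≤ q) (h1 : q ≤ 1) (x : ℝ) :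
    Real.exp (q * x) ≤ q * Real.exp x + (1 - q) := by
  have := convexOn_exp.2 (Set.mem_univ x) (Set.mem_univ 0) h0 (sub_nonneg.2 h1) (by ring)
  simpa using this

/-- An exponential moment bound around some constant upgrades to a `ψ₁` bound for a centred
function. -/
lemma lintegral_exp_abs_le_two {α : Type*} [MeasurableSpace α] {ν : Measure α}
    [IsProbabilityMeasure ν] {F : α → ℝ} (hF : Measurable F) {m L : ℝ} (hL : 1 ≤ L)
    (h : ∫⁻ x, ENNReal.ofReal (Real.exp (|F x - m| / 2)) ∂ν ≤ ENNReal.ofReal (Real.exp (3 * L)))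
    (h0 : ∫ x, F x ∂ν = 0) :
    ∫⁻ x, ENNReal.ofReal (Real.exp (|F x| / (24 * L))) ∂ν ≤ 2 := by
  have hFi := integrable_of_lintegral_exp_le hF h
  obtain ⟨hi, hle⟩ := integrable_exp_of_lintegral_le (by fun_prop) h
  have hd : Integrable (fun x => F x - m) ν := hFi.sub (integrable_const m)
  have e3 : ∀ x, Real.exp (|F x - m| / 2 - 3 * L) =
      Real.exp (-(3 * L)) * Real.exp (|F x - m| / 2) := fun x => by
    rw [← Real.exp_add]; ring_nf
  have hZi : Integrable (fun x => Real.exp (|F x - m| / 2 - 3 * L)) ν := by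
    simp_rw [e3]; exact hi.const_mul _
  have hZ : ∫ x, Real.exp (|F x - m| / 2 - 3 * L) ∂ν ≤ 1 := by
    simp_rw [e3]
    rw [integral_const_mul]
    calc _ ≤ Real.exp (-(3 * L)) * Real.exp (3 * L) := by gcongr
      _ = 1 := by rw [← Real.exp_add]; simp
  -- As `F` has mean zero, `|m| ≤ ∫ |F - m|`; integrating `1 + y ≤ e^y` at `y = |F - m| / 2 - 3L`
  -- bounds this by `6L`.
  have hm : |m| ≤ 6 * L := by
    have h1 : |m| ≤ ∫ x, |F x - m| ∂ν := by
      have := abs_integral_le_integral_abs (f := fun x => F x - m) (μ := ν)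
      rw [integral_sub hFi (integrable_const m), h0] at this
      simpa using this
    have h2 : ∫ x, (|F x - m| / 2 - 3 * L + 1) ∂ν ≤
        ∫ x, Real.exp (|F x - m| / 2 - 3 * L) ∂ν :=
      integral_mono (((hd.abs.div_const 2).sub (integrable_const _)).add (integrable_const _)) hZi
        fun x => Real.add_one_le_exp _
    rw [integral_add (by exact (hd.abs.div_const 2).sub (integrable_const _)) (integrable_const _),
      integral_sub (hd.abs.div_const 2) (integrable_const _), integral_div] at h2
    simp only [integral_const, probReal_univ, one_smul] at h2
    linarith
  have hL0 : 0 < L := by linarith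
  set q : ℝ := (12 * L)⁻¹ with hq
  have hqL : q * L = 1 / 12 := by rw [hq]; field_simp
  have hq0 : 0 ≤ q := by positivity
  have hq1 : q ≤ 1 := by nlinarith
  -- With `|m| / 2 ≤ 3L`, the exponent is at most `q (|F - m| / 2 - 3L) + 6qL`, and `6qL = 1/2` by
  -- the choice of `q`.
  have pt : ∀ x, Real.exp (|F x| / (24 * L)) ≤
      Real.exp (1 / 2) * (q * Real.exp (|F x - m| / 2 - 3 * L) + (1 - q)) := by
    intro x
    refine le_trans ?_ (mul_le_mul_of_nonneg_left
      (exp_mul_le_of_le_one hq0 hq1 (|F x - m| / 2 - 3 * L)) (Real.exp_pos _).le)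
    rw [← Real.exp_add]
    refine Real.exp_le_exp.2 ?_
    have h1 : |F x| ≤ |F x - m| + |m| := by simpa using abs_add_le (F x - m) m
    have h2 : |F x| / (24 * L) = q * (|F x| / 2) := by rw [hq]; field_simp; ring
    rw [h2]
    have h3 : q * (|F x| / 2) ≤ q * (|F x - m| / 2 + 3 * L) :=
      mul_le_mul_of_nonneg_left (by linarith) hq0
    linarith
  calc _ ≤ ∫⁻ x, ENNReal.ofReal
        (Real.exp (1 / 2) * (q * Real.exp (|F x - m| / 2 - 3 * L) + (1 - q))) ∂ν :=
        lintegral_mono fun x => ENNReal.ofReal_le_ofReal (pt x)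
    _ = ENNReal.ofReal (∫ x, Real.exp (1 / 2) *
        (q * Real.exp (|F x - m| / 2 - 3 * L) + (1 - q)) ∂ν) :=
        (ofReal_integral_eq_lintegral_ofReal
          (((hZi.const_mul q).add (integrable_const _)).const_mul _)
          (ae_of_all _ fun x => (Real.exp_pos _).le.trans (pt x))).symm
    _ ≤ ENNReal.ofReal 2 := by
        refine ENNReal.ofReal_le_ofReal ?_
        rw [integral_const_mul, integral_add (hZi.const_mul q) (integrable_const _),
          integral_const_mul]
        simp only [integral_const, probReal_univ, one_smul]
        have h1 : q * ∫ x, Real.exp (|F x - m| / 2 - 3 * L) ∂ν ≤ q * 1 :=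
          mul_le_mul_of_nonneg_left hZ hq0
        have h2 : Real.exp (1 / 2) ≤ 2 := by
          have : Real.exp (1 / 2) ^ 2 = Real.exp 1 := by rw [← Real.exp_nat_mul]; norm_num
          nlinarith [Real.exp_one_lt_d9, Real.exp_pos (1 / 2)]
        calc _ ≤ Real.exp (1 / 2) * 1 :=
              mul_le_mul_of_nonneg_left (by linarith) (Real.exp_pos _).le
          _ ≤ 2 := by linarith
    _ = 2 := by simp

/-! ### Restriction to a set of positive measure -/

lemma one_le_log_exp_div {a : ℝ} (h0 : 0 < a) (h1 : a ≤ 1) :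
    1 ≤ Real.log (Real.exp 1 / a) := by
  rw [Real.log_div (Real.exp_pos 1).ne' h0.ne', Real.log_exp]
  linarith [Real.log_nonpos h0.le h1]

/-- Restricting to a set of measure `a` costs at most a factor `1 / a` in exponential moments. -/
lemma exists_lintegral_cond_exp_abs_sub_le {n : ℕ} {A : Set (EuclideanSpace ℝ (Fin n))}
    (hA : 0 < twoSidedExp n A) {F : EuclideanSpace ℝ (Fin n) → ℝ} (hF : LipschitzWith 1 F) :
    ∃ m : ℝ, ∫⁻ x, ENNReal.ofReal (Real.exp (|F x - m| / 2)) ∂(cond (twoSidedExp n) A) ≤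
      ENNReal.ofReal (Real.exp (3 * Real.log (Real.exp 1 / (twoSidedExp n).real A))) := by
  obtain ⟨m, hm⟩ := exists_lintegral_exp_abs_sub_le hF
  refine ⟨m, ?_⟩
  set a := (twoSidedExp n).real A with ha
  have ha0 : 0 < a := ENNReal.toReal_pos hA.ne' (measure_ne_top _ _)
  have hL := one_le_log_exp_div ha0 measureReal_le_one
  have hinv : (twoSidedExp n A)⁻¹ = ENNReal.ofReal a⁻¹ := by
    rw [ENNReal.ofReal_inv_of_pos ha0, ha, ofReal_measureReal]
  rw [ProbabilityTheory.cond, lintegral_smul_measure, smul_eq_mul, hinv]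
  calc _ ≤ ENNReal.ofReal a⁻¹ * ENNReal.ofReal (Real.exp 3) := by
        gcongr
        exact (setLIntegral_le_lintegral _ _).trans hm
    -- `e³ / a = (e / a) e²`, and `2 ≤ 2L` because `L ≥ 1`.
    _ = ENNReal.ofReal (Real.exp (Real.log (Real.exp 1 / a) + 2)) := by
        rw [← ENNReal.ofReal_mul (by positivity), Real.exp_add, Real.exp_log (by positivity),
          show (3 : ℝ) = 1 + 2 by norm_num, Real.exp_add]
        congr 1
        field_simp
    _ ≤ _ := ENNReal.ofReal_le_ofReal (Real.exp_le_exp.2 (by linarith))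

/-- Centred functions that are Lipschitz on `A` have exponential moments at scale
`log (e / μ(A))` under the normalized restriction of `μ` to `A`. -/
lemma lintegral_cond_exp_abs_le_two {n : ℕ} {A : Set (EuclideanSpace ℝ (Fin n))}
    (hAm : NullMeasurableSet A (twoSidedExp n)) (hA : 0 < twoSidedExp n A)
    {f : EuclideanSpace ℝ (Fin n) → ℝ} (hf : LipschitzOnWith 1 f A)
    (h0 : ∫ x, f x ∂(cond (twoSidedExp n) A) = 0) :
    ∫⁻ x, ENNReal.ofReal (Real.exp
      (|f x| / (24 * Real.log (Real.exp 1 / (twoSidedExp n).real A)))) ∂(cond (twoSidedExp n) A)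
      ≤ 2 := by
  obtain ⟨F, hF, hfF⟩ := hf.extend_real
  have : IsProbabilityMeasure (cond (twoSidedExp n) A) := cond_isProbabilityMeasure hA.ne'
  have hae : f =ᵐ[cond (twoSidedExp n) A] F := by
    refine Measure.ae_smul_measure ?_ _
    filter_upwards [ae_restrict_mem₀ hAm] with x hx using hfF hx
  obtain ⟨m, hm⟩ := exists_lintegral_cond_exp_abs_sub_le hA hF
  rw [integral_congr_ae hae] at h0
  have hL := one_le_log_exp_div (ENNReal.toReal_pos hA.ne' (measure_ne_top _ _))
    (measureReal_le_one (μ := twoSidedExp n) (s := A))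
  refine le_trans (le_of_eq (lintegral_congr_ae ?_))
    (lintegral_exp_abs_le_two hF.continuous.measurable hL hm h0)
  filter_upwards [hae] with x hx
  rw [hx]
  rfl

end

/-- `ProbabilityTheory.cond (twoSidedExp n) A` is the normalized restriction `μ_A`, which gives no
mass to the complement of `A`; so only the restriction of `f` to `A` matters below. -/
theorem corollary6p3 :
    ∃ c : ℝ, 0 < c ∧
      ∀ (n : ℕ) (A : Set (EuclideanSpace ℝ (Fin n))),
        NullMeasurableSet A (twoSidedExp n) → 0 < twoSidedExp n A →
          (∀ f : EuclideanSpace ℝ (Fin n) → ℝ, LipschitzOnWith 1 f A →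
            ∫ x, f x ∂(ProbabilityTheory.cond (twoSidedExp n) A) = 0 →
              psiNorm 1 f (ProbabilityTheory.cond (twoSidedExp n) A) ≤
                ENNReal.ofReal (c * Real.log (Real.exp 1 / (twoSidedExp n).real A))) ∧
          spreadConst (ProbabilityTheory.cond (twoSidedExp n) A) ≤
            ENNReal.ofReal (c * Real.log (Real.exp 1 / (twoSidedExp n).real A) ^ 2) := by
  -- `2304 = 2 · 24² · 2`, as the variance bound requires; the `ψ₁` bound needs only `24`.
  refine ⟨2304, by norm_num, fun n A hAm hA => ?_⟩
  have hL := one_le_log_exp_div (ENNReal.toReal_pos hA.ne' (measure_ne_top _ _))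
    (measureReal_le_one (μ := twoSidedExp n) (s := A))
  change 1 ≤ Real.log (Real.exp 1 / (twoSidedExp n).real A) at hL
  have key := fun {f : EuclideanSpace ℝ (Fin n) → ℝ} =>
    lintegral_cond_exp_abs_le_two (f := f) hAm hA
  have : IsProbabilityMeasure (cond (twoSidedExp n) A) := cond_isProbabilityMeasure hA.ne'
  set L := Real.log (Real.exp 1 / (twoSidedExp n).real A)
  have hr : 0 < 24 * L := by linarith
  constructor
  · intro f hf h0
    refine (iInf_le_of_le (24 * L) (iInf_le_of_le hr (iInf_le_of_le ?_ le_rfl))).trans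
      (ENNReal.ofReal_le_ofReal (by linarith))
    simpa only [Real.rpow_one] using key hf h0
  · refine iSup₂_le fun f hf => ?_
    obtain ⟨m, hm⟩ := exists_lintegral_cond_exp_abs_sub_le hA hf
    have hfi := integrable_of_lintegral_exp_le hf.continuous.measurable hm
    set e := ∫ x, f x ∂(cond (twoSidedExp n) A) with he
    have hk := key (f := fun x => f x - e)
      (LipschitzOnWith.of_dist_le_mul fun x _ y _ => by simpa using hf.dist_le_mul x y)
      (by rw [integral_sub hfi (integrable_const e)]; simp [he])
    calc evariance f (cond (twoSidedExp n) A)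
        ≤ ∫⁻ x, ENNReal.ofReal (2 * (24 * L) ^ 2) *
          ENNReal.ofReal (Real.exp (|f x - e| / (24 * L))) ∂(cond (twoSidedExp n) A) := by
          refine lintegral_mono fun x => ?_
          rw [← ENNReal.ofReal_mul (by positivity), ← he, Real.enorm_eq_ofReal_abs,
            ← ENNReal.ofReal_pow (abs_nonneg _)]
          refine ENNReal.ofReal_le_ofReal ?_
          -- `z² ≤ 2 e^z` for `z = |f x - e| / (24L)` turns the `ψ₁` bound for `f - e` into a
          -- variance bound.
          have h1 := Real.quadratic_le_exp_of_nonneg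
            (div_nonneg (abs_nonneg (f x - e)) hr.le)
          have h2 : |f x - e| = |f x - e| / (24 * L) * (24 * L) := by field_simp
          have h3 := div_nonneg (abs_nonneg (f x - e)) hr.le
          set z := |f x - e| / (24 * L)
          rw [h2]
          nlinarith [sq_nonneg (24 * L)]
      _ = ENNReal.ofReal (2 * (24 * L) ^ 2) *
          ∫⁻ x, ENNReal.ofReal (Real.exp (|f x - e| / (24 * L))) ∂(cond (twoSidedExp n) A) :=
          lintegral_const_mul' _ _ ENNReal.ofReal_ne_top
      _ ≤ ENNReal.ofReal (2 * (24 * L) ^ 2) * ENNReal.ofReal 2 := by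
          gcongr
          simpa using hk
      _ = ENNReal.ofReal (2304 * L ^ 2) := by
          rw [← ENNReal.ofReal_mul (by positivity)]
          congr 1
          ring
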